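/- **Notation.** For positive reals $\lambda_1,\dots,\lambda_N$ (the capacities of $N$ nodes; they may depend on $N$) put $$\mu_N=\frac1N\sum_{i=1}^N\lambda_i,\qquad \nu_N=\frac{\sum_{i=1}^N\lambda_i^2}{\sum_{i=1}^N\lambda_i},\qquad f^{(N)}_n=\frac1N\sum_{i=1}^N e^{-\lambda_i}\frac{\lambda_i^n}{n!},\qquad g^{(N)}_n=\frac1{N\mu_N}\sum_{i=1}^N e^{-\lambda_i}\frac{\lambda_i^{n+1}}{n!}\quad(n\ge 0),$$ and $d_{\mathrm{TV}}(p,q)=\frac12\sum_{n\ge0}|p_n-q_n|$. Consider the following conditions on a family of capacities, as $N\to\infty$. * **(C1)** with limits $\mu\in(0,\infty)$, $\nu\in(1,\infty)$ and exponent $\alpha_1>0$: $|\mu_N-\mu|=O(N^{-\alpha_1})$ and $|\nu_N-\nu|=O(N^{-\alpha_1})$. * **(C2)** with limiting probability mass functions $f,g$ on $\{0,1,2,\dots\}$ and exponent $\alpha_2>0$: $d_{\mathrm{TV}}(f^{(N)},f)=O(N^{-\alpha_2})$ and $d_{\mathrm{TV}}(g^{(N)},g)=O(N^{-\alpha_2})$.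 * **(C3)** with exponent $\tau'>3$: for every $\varepsilon>0$ such that $\gamma:=\frac1{\tau'-1}+\varepsilon<\frac12$, $$\limsup_{N\to\infty}\frac1N\sum_{i=1}^N\lambda_i^{\tau'-1-\varepsilon}<\infty\qquad\text{and}\qquad \max_{1\le i\le N}\lambda_i\le N^{\gamma}\ \text{ for all large } N.\tag{1}$$ **Theorem 1.4.** Let $\Lambda,\Lambda_1,\Lambda_2,\dots$ be i.i.d. positive random variables with distribution function $F_\Lambda$, and suppose that there are constants $c>0$ and $\tau>3$ such that $1-F_\Lambda(x)\le c\,x^{1-\tau}$ for all $x>0$. Put $$\mu=\mathbb E[\Lambda],\qquad \nu=\frac{\mathbb E[\Lambda^2]}{\mathbb E[\Lambda]},\qquad f_n=\mathbb E\Big[e^{-\Lambda}\frac{\Lambda^n}{n!}\Big],\qquad g_n=\frac1\mu\,\mathbb E\Big[e^{-\Lambda}\frac{\Lambda^{n+1}}{n!}\Big]\quad(n\ge0),$$ and suppose that $\nu>1$. Then there are $\alpha_1,\alpha_2>0$ such that the following holds. 1. For every $\tau'\in(3,\tau)$ there are $\beta>0$ and measurable sets $\mathcal J_N\subseteq\mathbb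 R^N$ with $$\mathbb P\big((\Lambda_1,\dots,\Lambda_N)\in\mathcal J_N\big)=1-O(N^{-\beta})$$ such that every family of positive capacities with $(\lambda_1,\dots,\lambda_N)\in\mathcal J_N$ for all large $N$ satisfies (C1) with limits $\mu,\nu$ and exponent $\alpha_1$, (C2) with limits $f,g$ and exponent $\alpha_2$, and (C3) with exponent $\tau'$. 2. For every fixed $\varepsilon>0$ with $\frac1{\tau-1}+\varepsilon<\frac12$ there are $\beta>0$ and measurable sets $\mathcal J_N\subseteq\mathbb R^N$ with the same probability bound such that every family of positive capacities with $(\lambda_1,\dots,\lambda_N)\in\mathcal J_N$ for all large $N$ satisfies (C1) and (C2) as in part 1, and the two bounds (1) for the original exponent $\tau$ (that is, with $\tau'=\tau$) and this $\varepsilon$. -/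

import Mathlib

open MeasureTheory ProbabilityTheory Filter Asymptotics

noncomputable section

namespace CapacityGraph

/-- A triangular array of capacities: for every number `N` of nodes, the capacities
`λ_1, …, λ_N` (indexed here by `Fin N`), which may change with `N`. -/
abbrev Capacities : Type := (N : ℕ) → Fin N → ℝ

/-- `μ_N = (1/N) ∑ λ_i`. -/
def meanN {N : ℕ} (x : Fin N → ℝ) : ℝ := (1 / (N : ℝ)) * ∑ i, x i

/-- `ν_N = ∑ λ_i² / ∑ λ_i`. -/
def nuN {N : ℕ} (x : Fin N → ℝ) : ℝ := (∑ i, x i ^ 2) / ∑ i, x i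

/-- `f_n^{(N)} = (1/N) ∑ e^{-λ_i} λ_i^n / n!`. -/
def fN {N : ℕ} (x : Fin N → ℝ) (n : ℕ) : ℝ :=
  (1 / (N : ℝ)) * ∑ i, Real.exp (-x i) * x i ^ n / (n.factorial : ℝ)

/-- `g_n^{(N)} = (1/(N μ_N)) ∑ e^{-λ_i} λ_i^{n+1} / n!`. -/
def gN {N : ℕ} (x : Fin N → ℝ) (n : ℕ) : ℝ :=
  (1 / ((N : ℝ) * meanN x)) * ∑ i, Real.exp (-x i) * x i ^ (n + 1) / (n.factorial : ℝ)

/-- `p` is a probability mass function on `{0, 1, 2, …}`. -/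
def IsProbMass (p : ℕ → ℝ) : Prop := (∀ n, 0 ≤ p n) ∧ HasSum p 1

/-- The total variation distance of two probability mass functions on `{0, 1, 2, …}`. -/
def dTV (p q : ℕ → ℝ) : ℝ := (1 / 2) * ∑' n, |p n - q n|

/-- Convergence of means, with limits `μ`, `ν` and rate exponent `α`. -/
def CondC1 (lam : Capacities) (μ ν α : ℝ) : Prop :=
  0 < μ ∧ 1 < ν ∧ 0 < α ∧
    (fun N : ℕ => |meanN (lam N) - μ|) =O[atTop] (fun N : ℕ => (N : ℝ) ^ (-α)) ∧
    (fun N : ℕ => |nuN (lam N) - ν|) =O[atTop] (fun N : ℕ => (N : ℝ) ^ (-α))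

/-- Convergence of the offspring laws, with limit laws `f`, `g` and rate exponent `α`.
That `f` and `g` are probability mass functions is part of the condition, so for positive
capacities and `N ≥ 1` the series in `dTV` converge. -/
def CondC2 (lam : Capacities) (f g : ℕ → ℝ) (α : ℝ) : Prop :=
  IsProbMass f ∧ IsProbMass g ∧ 0 < α ∧
    (fun N : ℕ => dTV (fN (lam N)) f) =O[atTop] (fun N : ℕ => (N : ℝ) ^ (-α)) ∧
    (fun N : ℕ => dTV (gN (lam N)) g) =O[atTop] (fun N : ℕ => (N : ℝ) ^ (-α))

/-- The moment bound and the bound on the maximal capacity, for one pair `(τ, ε)`: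
`limsup (1/N) ∑ λ_i^{τ-1-ε} < ∞`, and `max_i λ_i ≤ N^γ` for all large `N`, where
`γ = 1/(τ-1) + ε`. The limsup is taken in the extended reals. -/
def CondC3At (lam : Capacities) (τ ε : ℝ) : Prop :=
  limsup (fun N : ℕ => (((1 / (N : ℝ)) * ∑ i, lam N i ^ (τ - 1 - ε) : ℝ) : EReal)) atTop < ⊤ ∧
    ∀ᶠ N : ℕ in atTop, ∀ i : Fin N, lam N i ≤ (N : ℝ) ^ (1 / (τ - 1) + ε)

/-- The moment and maximal bound with exponent `τ > 3`: it holds for every `ε > 0` for which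
`γ = 1/(τ-1) + ε < 1/2`. -/
def CondC3 (lam : Capacities) (τ : ℝ) : Prop :=
  3 < τ ∧ ∀ ε : ℝ, 0 < ε → 1 / (τ - 1) + ε < 1 / 2 → CondC3At lam τ ε

variable {Ω : Type*} [MeasurableSpace Ω]

/-- `μ = E[Λ]`. -/
def mu (P : Measure Ω) (X : Ω → ℝ) : ℝ := ∫ ω, X ω ∂P

/-- `ν = E[Λ²] / E[Λ]`. -/
def nu (P : Measure Ω) (X : Ω → ℝ) : ℝ := (∫ ω, X ω ^ 2 ∂P) / ∫ ω, X ω ∂P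

/-- The mixed Poisson law `f_n = E[e^{-Λ} Λ^n / n!]`. -/
def fLim (P : Measure Ω) (X : Ω → ℝ) (n : ℕ) : ℝ :=
  ∫ ω, Real.exp (-X ω) * X ω ^ n / (n.factorial : ℝ) ∂P

/-- The size-biased mixed Poisson law `g_n = (1/μ) E[e^{-Λ} Λ^{n+1} / n!]`. -/
def gLim (P : Measure Ω) (X : Ω → ℝ) (n : ℕ) : ℝ :=
  (1 / mu P X) * ∫ ω, Real.exp (-X ω) * X ω ^ (n + 1) / (n.factorial : ℝ) ∂P

/-- The events `{(Λ_1, …, Λ_N) ∈ J_N}` have probability `1 - O(N^{-β})`. The random variables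
`Λ_1, Λ_2, …` are written `L 0, L 1, …`. -/
def HasProbOneSubPoly (P : Measure Ω) (L : ℕ → Ω → ℝ)
    (J : (N : ℕ) → Set (Fin N → ℝ)) (β : ℝ) : Prop :=
  (∀ N, MeasurableSet (J N)) ∧
    (fun N : ℕ => 1 - P.real {ω | (fun i : Fin N => L i ω) ∈ J N})
      =O[atTop] (fun N : ℕ => (N : ℝ) ^ (-β))

/-- Every array of positive capacities with `(λ_1, …, λ_N) ∈ J_N` for all large `N` has the
property `Q`. (Only large `N` matter, so an empty `J_N` for some small `N` does not make this
void; as all such arrays are considered, the bounds that `Q` gives are uniform over `J_N`.) -/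
def HoldsOn (J : (N : ℕ) → Set (Fin N → ℝ)) (Q : Capacities → Prop) : Prop :=
  ∀ lam : Capacities, (∀ N i, 0 < lam N i) → (∀ᶠ N : ℕ in atTop, lam N ∈ J N) → Q lam

end CapacityGraph

end

noncomputable section
namespace CapacityGraph

/-! All quantities in the three conditions are functions of empirical averages of `y`, `y ^ 2`,
powers `y ^ p`, and the statistics `poissonWeight n y` and `y * poissonWeight n y`. It therefore
suffices that these averages are polynomially close to their expectations outside an event of
polynomially small probability; the rest is deterministic.

The tail bound gives moments of every order below `τ - 1`. Since `τ - 1 > 2`, the square `Λ ^ 2` has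
a moment of some order `s > 1`, but possibly no variance, so plain Chebyshev is not enough.
`hasProbOneSubPoly_avg` truncates at level `N` and applies Chebyshev to the truncated variable.

For total variation, infinitely many indices must be controlled. Indices below about `N ^ (1/8)` are
handled by Chebyshev and a union bound, with error `N ^ (-1/4)` each, hence a total of order `N ^
(-1/8)`. Larger indices are handled by Markov's inequality: the first moments of the unnormalised
sequences are the first and second moments of the capacities, which are bounded, so the tails are
again of order `N ^ (-1/8)` (`tsum_abs_sub_le`). The size-biased law is compared before
normalisation, and `tsum_abs_div_sub_div_le` then divides by the means.

The bound on the maximum is a union bound, which has room to spare because either `τ' < τ` or `ε >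
0`. -/

/-- The empirical average of `h` over the coordinates of `x`. -/
def avg (h : ℝ → ℝ) {N : ℕ} (x : Fin N → ℝ) : ℝ := (1 / (N : ℝ)) * ∑ i, h (x i)

lemma measurable_avg {h : ℝ → ℝ} (hh : Measurable h) (N : ℕ) :
    Measurable (fun x : Fin N → ℝ => avg h x) := by
  unfold avg
  fun_prop

/-! ### Concentration of empirical averages of i.i.d. variables. -/

section Probability

variable {Ω : Type*} [MeasurableSpace Ω] {P : Measure Ω} {L : ℕ → Ω → ℝ}

lemma identDistrib_comp (hident : ∀ i, IdentDistrib (L i) (L 0) P P) {h : ℝ → ℝ}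
    (hh : Measurable h) (i : ℕ) :
    IdentDistrib (fun ω => h (L i ω)) (fun ω => h (L 0 ω)) P P :=
  (hident i).comp hh

variable [IsProbabilityMeasure P]

/-- Chebyshev's inequality for empirical averages. -/
lemma prob_avg_deviation_le (hindep : iIndepFun L P)
    (hident : ∀ i, IdentDistrib (L i) (L 0) P P) {h : ℝ → ℝ} (hh : Measurable h)
    (h2 : MemLp (fun ω => h (L 0 ω)) 2 P) {N : ℕ} (hN : 0 < N) {δ : ℝ} (hδ : 0 < δ) :
    P.real {ω | δ ≤ |avg h (fun i : Fin N => L i ω) - ∫ ω, h (L 0 ω) ∂P|} ≤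
      (∫ ω, h (L 0 ω) ^ 2 ∂P) / (N * δ ^ 2) := by
  have hN' : (0 : ℝ) < N := by exact_mod_cast hN
  have hid := identDistrib_comp hident hh
  have hL2 : ∀ i, MemLp (fun ω => h (L i ω)) 2 P := fun i => (hid i).memLp_iff.2 h2
  set S : Ω → ℝ := ∑ i : Fin N, fun ω => h (L i ω) with hS
  have hSL2 : MemLp S 2 P := memLp_finsetSum' _ (fun i _ => hL2 i)
  have hvarS : variance S P = N * variance (fun ω => h (L 0 ω)) P := by
    rw [hS, IndepFun.variance_sum (X := fun (i : Fin N) ω => h (L i ω)) (fun i _ => hL2 i)]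
    · simp [fun i : Fin N => (hid i).variance_eq]
    · intro i _ j _ hij
      exact (hindep.indepFun (fun hc => hij (Fin.ext hc))).comp hh hh
  have havg : (fun ω => avg h (fun i : Fin N => L i ω)) = fun ω => (1 / (N : ℝ)) * S ω := by
    funext ω
    simp [avg, hS]
  have hmean : ∫ ω, (1 / (N : ℝ)) * S ω ∂P = ∫ ω, h (L 0 ω) ∂P := by
    rw [integral_const_mul]
    have : ∫ ω, S ω ∂P = N * ∫ ω, h (L 0 ω) ∂P := by
      simp only [hS, Finset.sum_apply]
      rw [integral_finsetSum (f := fun (i : Fin N) ω => h (L i ω)) _ (fun i _ => (hL2 i).integrable (by norm_num))]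
      simp [fun i : Fin N => (hid i).integral_eq]
    rw [this]
    field_simp
  have hcheb := meas_ge_le_variance_div_sq (μ := P) (X := fun ω => (1 / (N : ℝ)) * S ω)
    (hSL2.const_mul _) hδ
  rw [hmean] at hcheb
  have hset : {ω | δ ≤ |avg h (fun i : Fin N => L i ω) - ∫ ω, h (L 0 ω) ∂P|} =
      {ω | δ ≤ |(1 / (N : ℝ)) * S ω - ∫ ω, h (L 0 ω) ∂P|} := by
    ext ω
    simp only [Set.mem_ofPred_eq]
    rw [show avg h (fun i : Fin N => L i ω) = (1 / (N : ℝ)) * S ω from congrFun havg ω]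
  rw [hset]
  refine (ENNReal.toReal_le_of_le_ofReal (div_nonneg (variance_nonneg _ _)
    (sq_nonneg _)) hcheb).trans ?_
  rw [variance_const_mul, hvarS]
  have hv : variance (fun ω => h (L 0 ω)) P ≤ ∫ ω, h (L 0 ω) ^ 2 ∂P :=
    variance_le_expectation_sq h2.1
  calc (1 / (N : ℝ)) ^ 2 * (N * variance (fun ω => h (L 0 ω)) P) / δ ^ 2
      = variance (fun ω => h (L 0 ω)) P / (N * δ ^ 2) := by field_simp
    _ ≤ _ := by gcongr

/-- A bound on the probabilities of the complements gives `HasProbOneSubPoly`. -/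
lemma HasProbOneSubPoly.of_compl_le (hmeas : ∀ i, Measurable (L i))
    {J : (N : ℕ) → Set (Fin N → ℝ)} (hJ : ∀ N, MeasurableSet (J N)) {β : ℝ} (C : ℝ)
    (hC : ∀ᶠ N : ℕ in atTop,
      P.real {ω | (fun i : Fin N => L i ω) ∉ J N} ≤ C * (N : ℝ) ^ (-β)) :
    HasProbOneSubPoly P L J β := by
  refine ⟨hJ, IsBigO.of_bound C ?_⟩
  filter_upwards [hC] with N hN
  have hm : MeasurableSet {ω | (fun i : Fin N => L i ω) ∈ J N} :=
    measurable_pi_lambda (fun ω (i : Fin N) => L i ω) (fun i => hmeas i) (hJ N)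
  have hc : 1 - P.real {ω | (fun i : Fin N => L i ω) ∈ J N} =
      P.real {ω | (fun i : Fin N => L i ω) ∉ J N} := by
    rw [← probReal_compl_eq_one_sub hm]
    rfl
  rw [hc, Real.norm_of_nonneg measureReal_nonneg,
    Real.norm_of_nonneg (Real.rpow_nonneg (Nat.cast_nonneg N) _)]
  exact hN

lemma HasProbOneSubPoly.mono {J J' : (N : ℕ) → Set (Fin N → ℝ)} {β : ℝ} (h : HasProbOneSubPoly P L J β)
    (hJ' : ∀ N, MeasurableSet (J' N)) (hsub : ∀ᶠ N in atTop, J N ⊆ J' N) :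
    HasProbOneSubPoly P L J' β := by
  refine ⟨hJ', IsBigO.trans (IsBigO.of_bound 1 ?_) h.2⟩
  filter_upwards [hsub] with N hN
  have h1 : P.real {ω | (fun i : Fin N => L i ω) ∈ J N} ≤
      P.real {ω | (fun i : Fin N => L i ω) ∈ J' N} :=
    measureReal_mono fun ω hω => hN hω
  have h2 : P.real {ω | (fun i : Fin N => L i ω) ∈ J' N} ≤ 1 := measureReal_le_one
  rw [Real.norm_of_nonneg (by linarith), Real.norm_of_nonneg (by linarith)]
  linarith

lemma HasProbOneSubPoly.inter (hmeas : ∀ i, Measurable (L i))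
    {J J' : (N : ℕ) → Set (Fin N → ℝ)} {β β' : ℝ} (h : HasProbOneSubPoly P L J β)
    (h' : HasProbOneSubPoly P L J' β') :
    HasProbOneSubPoly P L (fun N => J N ∩ J' N) (min β β') := by
  refine ⟨fun N => (h.1 N).inter (h'.1 N), ?_⟩
  have key : ∀ b : ℝ, min β β' ≤ b →
      (fun N : ℕ => (N : ℝ) ^ (-b)) =O[atTop] (fun N : ℕ => (N : ℝ) ^ (-(min β β'))) := by
    intro b hb
    refine IsBigO.of_bound 1 ?_
    filter_upwards [eventually_ge_atTop 1] with N hN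
    rw [Real.norm_of_nonneg (Real.rpow_nonneg (Nat.cast_nonneg N) _),
      Real.norm_of_nonneg (Real.rpow_nonneg (Nat.cast_nonneg N) _), one_mul]
    exact Real.rpow_le_rpow_of_exponent_le (by exact_mod_cast hN) (by linarith)
  refine IsBigO.trans (IsBigO.of_bound 1 (Eventually.of_forall fun N => ?_))
    ((h.2.trans (key β (min_le_left _ _))).add (h'.2.trans (key β' (min_le_right _ _))))
  have hm : Measurable fun ω => (fun i : Fin N => L i ω) :=
    measurable_pi_lambda _ fun i => hmeas i
  have e : ∀ {K : Set (Fin N → ℝ)}, MeasurableSet K →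
      1 - P.real {ω | (fun i : Fin N => L i ω) ∈ K} =
        P.real {ω | (fun i : Fin N => L i ω) ∈ K}ᶜ := fun hK =>
    (probReal_compl_eq_one_sub (hm hK)).symm
  rw [e (h.1 N), e (h'.1 N), e ((h.1 N).inter (h'.1 N)), one_mul,
    Real.norm_of_nonneg measureReal_nonneg,
    Real.norm_of_nonneg (add_nonneg measureReal_nonneg measureReal_nonneg)]
  refine le_trans (measureReal_mono ?_) (measureReal_union_le _ _)
  intro ω hω
  by_contra hc
  simp only [Set.mem_union, Set.mem_compl_iff, Set.mem_ofPred_eq, not_or, not_not] at hc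
  exact hω ⟨hc.1, hc.2⟩

/-- Uniform Chebyshev bound for polynomially many statistics with bounded second moment. -/
lemma hasProbOneSubPoly_avg_family (hmeas : ∀ i, Measurable (L i)) (hindep : iIndepFun L P)
    (hident : ∀ i, IdentDistrib (L i) (L 0) P P) {h : ℕ → ℝ → ℝ} (hh : ∀ n, Measurable (h n))
    (h2 : ∀ n, MemLp (fun ω => h n (L 0 ω)) 2 P) {m : ℝ}
    (hm : ∀ n, ∫ ω, h n (L 0 ω) ^ 2 ∂P ≤ m) :
    HasProbOneSubPoly P L (fun N => {x | ∀ n < ⌈(N : ℝ) ^ (1 / 8 : ℝ)⌉₊,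
      |avg (h n) x - ∫ ω, h n (L 0 ω) ∂P| < (N : ℝ) ^ (-(1 / 4) : ℝ)}) (3 / 8) := by
  have hm0 : 0 ≤ m := (integral_nonneg fun ω => sq_nonneg _).trans (hm 0)
  refine HasProbOneSubPoly.of_compl_le hmeas (fun N => ?_) (2 * m) ?_
  · simp only [Set.ofPred_forall]
    refine MeasurableSet.iInter fun n => MeasurableSet.iInter fun _ => ?_
    exact measurableSet_lt ((measurable_avg (hh n) N).sub_const _).abs measurable_const
  filter_upwards [eventually_ge_atTop 1] with N hN
  have hN1 : (1 : ℝ) ≤ N := by exact_mod_cast hN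
  have hN0 : (0 : ℝ) < N := by linarith
  set M := ⌈(N : ℝ) ^ (1 / 8 : ℝ)⌉₊
  have hM : (M : ℝ) ≤ 2 * (N : ℝ) ^ (1 / 8 : ℝ) := by
    have h1 : (1 : ℝ) ≤ (N : ℝ) ^ (1 / 8 : ℝ) := Real.one_le_rpow hN1 (by norm_num)
    have := (Nat.ceil_lt_add_one (Real.rpow_nonneg hN0.le (1 / 8 : ℝ))).le
    linarith
  have hsub : {ω | (fun i : Fin N => L i ω) ∉ {x : Fin N → ℝ | ∀ n < M,
      |avg (h n) x - ∫ ω, h n (L 0 ω) ∂P| < (N : ℝ) ^ (-(1 / 4) : ℝ)}} ⊆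
      ⋃ n ∈ Finset.range M, {ω | (N : ℝ) ^ (-(1 / 4) : ℝ) ≤
        |avg (h n) (fun i : Fin N => L i ω) - ∫ ω, h n (L 0 ω) ∂P|} := by
    intro ω hω
    simpa using hω
  refine (measureReal_mono hsub (measure_ne_top _ _)).trans ((measureReal_biUnion_finset_le _ _).trans ?_)
  -- There are at most `2 N^(1/8)` events, each of probability at most `m / (N · N^(-1/2))`, which
  -- gives the exponent `1/8 - 1/2 = -3/8`.
  calc _ ≤ ∑ n ∈ Finset.range M, m / (N * ((N : ℝ) ^ (-(1 / 4) : ℝ)) ^ 2) := by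
        refine Finset.sum_le_sum fun n _ => ?_
        refine (prob_avg_deviation_le hindep hident (hh n) (h2 n) hN (by positivity)).trans ?_
        have := hm n
        gcongr
    _ = M * (m / (N * ((N : ℝ) ^ (-(1 / 4) : ℝ)) ^ 2)) := by simp
    _ ≤ (2 * (N : ℝ) ^ (1 / 8 : ℝ)) * (m / (N * ((N : ℝ) ^ (-(1 / 4) : ℝ)) ^ 2)) := by
        gcongr
    _ = 2 * m * (N : ℝ) ^ (-(3 / 8) : ℝ) := by
        have e1 : (N : ℝ) * ((N : ℝ) ^ (-(1 / 4) : ℝ)) ^ 2 = (N : ℝ) ^ (1 / 2 : ℝ) := by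
          rw [← Real.rpow_natCast, ← Real.rpow_mul hN0.le]
          nth_rewrite 1 [← Real.rpow_one (N : ℝ)]
          rw [← Real.rpow_add hN0]
          norm_num
        have e2 : (N : ℝ) ^ (-(3 / 8) : ℝ) = (N : ℝ) ^ (1 / 8 : ℝ) / (N : ℝ) ^ (1 / 2 : ℝ) := by
          rw [← Real.rpow_sub hN0]
          norm_num
        rw [e1, e2]
        ring

/-- The weak law of large numbers with a polynomial rate, under a moment of order `s ∈ (1, 2]`. -/
lemma hasProbOneSubPoly_avg (hmeas : ∀ i, Measurable (L i)) (hindep : iIndepFun L P)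
    (hident : ∀ i, IdentDistrib (L i) (L 0) P P) {h : ℝ → ℝ} (hh : Measurable h) {s a : ℝ}
    (hs2 : s ≤ 2) (ha : 0 < a) (has : 2 * a < s - 1)
    (hint : Integrable (fun ω => |h (L 0 ω)| ^ s) P) (hint1 : Integrable (fun ω => h (L 0 ω)) P) :
    HasProbOneSubPoly P L (fun N => {x | |avg h x - ∫ ω, h (L 0 ω) ∂P| ≤ (N : ℝ) ^ (-a)})
      (s - 1 - 2 * a) := by
  set m : ℝ := ∫ ω, |h (L 0 ω)| ^ s ∂P with hmdef
  have hm0 : 0 ≤ m := integral_nonneg fun ω => Real.rpow_nonneg (abs_nonneg _) _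
  have hs1 : 1 < s := by linarith
  -- The constant is `1 + 4`: `m` for the event that some value reaches the truncation level, `4 *
  -- m` from Chebyshev with deviation `N^(-a) / 2`.
  refine HasProbOneSubPoly.of_compl_le hmeas (fun N => ?_) (5 * m) ?_
  · exact measurableSet_le ((measurable_avg hh N).sub_const _).abs measurable_const
  -- Truncation shifts the mean by at most `m N^(1-s)`. As `a < s - 1`, this is eventually at most a
  -- quarter of the allowed deviation `N^(-a)`.
  have hsmall : ∀ᶠ N : ℕ in atTop, m * (N : ℝ) ^ (1 - s + a) ≤ 1 / 4 := by
    have ht : Tendsto (fun N : ℕ => m * (N : ℝ) ^ (1 - s + a)) atTop (nhds (m * 0)) := by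
      have := (tendsto_rpow_neg_atTop (y := s - 1 - a) (by linarith)).comp
        (tendsto_natCast_atTop_atTop (R := ℝ))
      refine Tendsto.const_mul m (this.congr fun N => ?_)
      simp only [Function.comp]
      congr 1
      ring
    rw [mul_zero] at ht
    exact ht.eventually (ge_mem_nhds (by norm_num))
  filter_upwards [eventually_ge_atTop 1, hsmall] with N hN hNs
  have hN1 : (1 : ℝ) ≤ N := by exact_mod_cast hN
  have hN0 : (0 : ℝ) < N := by linarith
  set h' : ℝ → ℝ := fun x => if |h x| ≤ N then h x else 0 with hh'def
  have hh' : Measurable h' :=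
    Measurable.ite (measurableSet_le hh.abs measurable_const) hh measurable_const
  have hbd : ∀ x, |h' x| ≤ N := by
    intro x
    by_cases hx : |h x| ≤ N <;> simp [hh'def, hx]
  have hL2 : MemLp (fun ω => h' (L 0 ω)) 2 P :=
    MemLp.of_bound (hh'.comp (hmeas 0)).aestronglyMeasurable N
      (Eventually.of_forall fun ω => by simpa using hbd (L 0 ω))
  -- Where `|h| ≤ N`, split `|h|^2 = |h|^(2-s) |h|^s` and bound the first factor; this is where `s ≤
  -- 2` enters.
  have hsq : ∀ x, h' x ^ 2 ≤ (N : ℝ) ^ (2 - s) * |h x| ^ s := by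
    intro x
    by_cases hx : |h x| ≤ N
    · simp only [hh'def, hx, if_true]
      rcases (abs_nonneg (h x)).eq_or_lt with h0 | h0
      · rw [abs_eq_zero.1 h0.symm]
        simp only [ne_eq, OfNat.ofNat_ne_zero, not_false_eq_true, zero_pow]
        positivity
      · rw [← sq_abs, ← Real.rpow_natCast, show ((2 : ℕ) : ℝ) = (2 - s) + s by push_cast; ring,
          Real.rpow_add h0]
        gcongr
    · simp only [hh'def, hx, if_false]
      rw [zero_pow two_ne_zero]
      positivity
  have hdiff : ∀ x, |h' x - h x| ≤ (N : ℝ) ^ (1 - s) * |h x| ^ s := by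
    intro x
    by_cases hx : |h x| ≤ N
    · simp only [hh'def, hx, if_true, sub_self, abs_zero]
      positivity
    · simp only [hh'def, hx, if_false, zero_sub, abs_neg]
      push Not at hx
      have h0 : 0 < |h x| := hN0.trans hx
      have e : |h x| = |h x| ^ (1 - s) * |h x| ^ s := by
        rw [← Real.rpow_add h0]; simp
      calc |h x| = |h x| ^ (1 - s) * |h x| ^ s := e
        _ ≤ _ := mul_le_mul_of_nonneg_right
          (Real.rpow_le_rpow_of_nonpos hN0 hx.le (by linarith)) (by positivity)
  have hE2 : ∫ ω, h' (L 0 ω) ^ 2 ∂P ≤ (N : ℝ) ^ (2 - s) * m := by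
    rw [hmdef, ← integral_const_mul]
    exact integral_mono hL2.integrable_sq (hint.const_mul _) fun ω => hsq _
  have hE1 : |∫ ω, h' (L 0 ω) ∂P - ∫ ω, h (L 0 ω) ∂P| ≤ (N : ℝ) ^ (1 - s) * m := by
    rw [← integral_sub (hL2.integrable (by norm_num)) hint1]
    refine abs_integral_le_integral_abs.trans ?_
    rw [hmdef, ← integral_const_mul]
    exact integral_mono ((hL2.integrable (by norm_num)).sub hint1).abs (hint.const_mul _)
      fun ω => hdiff _
  have hE1' : |∫ ω, h' (L 0 ω) ∂P - ∫ ω, h (L 0 ω) ∂P| ≤ (N : ℝ) ^ (-a) / 4 := by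
    refine hE1.trans ?_
    have e : (N : ℝ) ^ (1 - s) * m = (N : ℝ) ^ (-a) * (m * (N : ℝ) ^ (1 - s + a)) := by
      rw [show 1 - s = -a + (1 - s + a) by ring, Real.rpow_add hN0]
      ring_nf
    rw [e]
    have := mul_le_mul_of_nonneg_left hNs (Real.rpow_nonneg hN0.le (-a))
    linarith
  -- If no value reaches `N`, truncation does not change the average. A truncated deviation below
  -- `N^(-a) / 2` and a bias of at most `N^(-a) / 4` then keep the total within `N^(-a)`.
  have hsub : {ω | (fun i : Fin N => L i ω) ∉
      {x : Fin N → ℝ | |avg h x - ∫ ω, h (L 0 ω) ∂P| ≤ (N : ℝ) ^ (-a)}} ⊆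
      (⋃ i ∈ (Finset.univ : Finset (Fin N)), {ω | (N : ℝ) ^ s ≤ |h (L i ω)| ^ s}) ∪
      {ω | (N : ℝ) ^ (-a) / 2 ≤
        |avg h' (fun i : Fin N => L i ω) - ∫ ω, h' (L 0 ω) ∂P|} := by
    intro ω hω
    by_contra hc
    simp only [Finset.mem_univ, Set.iUnion_true, Set.mem_union, Set.mem_iUnion, Set.mem_ofPred_eq,
      not_or, not_exists, not_le] at hc
    have heq : avg h' (fun i : Fin N => L i ω) = avg h (fun i : Fin N => L i ω) := by
      unfold avg
      congr 1
      refine Finset.sum_congr rfl fun i _ => ?_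
      have := (Real.rpow_lt_rpow_iff (abs_nonneg _) hN0.le (by linarith)).1 (hc.1 i)
      simp [hh'def, this.le]
    rw [heq] at hc
    apply hω
    simp only [Set.mem_ofPred_eq]
    have hpos : 0 < (N : ℝ) ^ (-a) := Real.rpow_pos_of_pos hN0 _
    have := abs_sub_le (avg h (fun i : Fin N => L i ω)) (∫ ω, h' (L 0 ω) ∂P)
      (∫ ω, h (L 0 ω) ∂P)
    linarith [hc.2]
  have hmark : ∀ i : ℕ, P.real {ω | (N : ℝ) ^ s ≤ |h (L i ω)| ^ s} ≤ m / (N : ℝ) ^ s := by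
    intro i
    have hid : IdentDistrib (fun ω => |h (L i ω)| ^ s) (fun ω => |h (L 0 ω)| ^ s) P P :=
      identDistrib_comp (h := fun x => |h x| ^ s) hident (by fun_prop) i
    rw [le_div_iff₀ (by positivity), mul_comm]
    refine (mul_meas_ge_le_integral_of_nonneg (Eventually.of_forall fun ω => by positivity)
      (hid.integrable_iff.2 hint) _).trans_eq ?_
    rw [hid.integral_eq]
  refine (measureReal_mono hsub (measure_ne_top _ _)).trans ((measureReal_union_le _ _).trans ?_)
  have hb1 : P.real (⋃ i ∈ (Finset.univ : Finset (Fin N)), {ω | (N : ℝ) ^ s ≤ |h (L i ω)| ^ s}) ≤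
      m * (N : ℝ) ^ (-(s - 1 - 2 * a)) := by
    refine (measureReal_biUnion_finset_le _ _).trans
      ((Finset.sum_le_sum fun (i : Fin N) _ => hmark i).trans ?_)
    simp only [Finset.sum_const, Finset.card_univ, Fintype.card_fin, nsmul_eq_mul]
    have e : (N : ℝ) * (m / (N : ℝ) ^ s) = m * (N : ℝ) ^ (1 - s) := by
      rw [Real.rpow_sub hN0, Real.rpow_one]
      ring
    rw [e]
    exact mul_le_mul_of_nonneg_left
      (Real.rpow_le_rpow_of_exponent_le hN1 (by linarith)) hm0
  have hb2 : P.real {ω | (N : ℝ) ^ (-a) / 2 ≤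
        |avg h' (fun i : Fin N => L i ω) - ∫ ω, h' (L 0 ω) ∂P|} ≤
      4 * m * (N : ℝ) ^ (-(s - 1 - 2 * a)) := by
    refine (prob_avg_deviation_le hindep hident hh' hL2 hN (by positivity)).trans ?_
    rw [div_le_iff₀ (by positivity)]
    refine hE2.trans_eq ?_
    have e : (N : ℝ) ^ (2 - s) = (N : ℝ) ^ (-(s - 1 - 2 * a)) * N * ((N : ℝ) ^ (-a)) ^ 2 := by
      rw [← Real.rpow_natCast, ← Real.rpow_mul hN0.le]
      nth_rewrite 3 [← Real.rpow_one (N : ℝ)]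
      rw [← Real.rpow_add hN0, ← Real.rpow_add hN0]
      congr 1
      push_cast
      ring
    rw [e]
    ring
  linarith

end Probability

/-! ### Poisson weights and comparison of sequences in `ℓ¹`. -/

/-- The Poisson weight `e^{-x} x^n / n!`. -/
def poissonWeight (n : ℕ) (x : ℝ) : ℝ := Real.exp (-x) * x ^ n / (n.factorial : ℝ)

lemma measurable_poissonWeight (n : ℕ) : Measurable (poissonWeight n) := by
  unfold poissonWeight
  fun_prop

lemma poissonWeight_nonneg (n : ℕ) {x : ℝ} (hx : 0 ≤ x) : 0 ≤ poissonWeight n x := by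
  unfold poissonWeight
  positivity

lemma hasSum_poissonWeight (x : ℝ) : HasSum (fun n => poissonWeight n x) 1 := by
  have h := (NormedSpace.expSeries_div_hasSum_exp (𝔸 := ℝ) x).mul_left (Real.exp (-x))
  rw [← Real.exp_eq_exp_ℝ, ← Real.exp_add, neg_add_cancel, Real.exp_zero] at h
  simpa only [poissonWeight, mul_div_assoc] using h

lemma hasSum_mul_poissonWeight (x : ℝ) : HasSum (fun n : ℕ => (n : ℝ) * poissonWeight n x) x := by
  have h := (hasSum_poissonWeight x).mul_left x
  rw [mul_one] at h
  -- The term at `0` vanishes, and `(n + 1) * poissonWeight (n + 1) x = x * poissonWeight n x`.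
  rw [← hasSum_nat_add_iff' 1]
  simp only [Finset.range_one, Finset.sum_singleton, Nat.cast_zero, zero_mul, sub_zero]
  refine h.congr_fun fun n => ?_
  unfold poissonWeight
  rw [Nat.factorial_succ]
  push_cast
  have : (n.factorial : ℝ) ≠ 0 := by positivity
  field_simp
  ring

lemma poissonWeight_le_one (n : ℕ) {x : ℝ} (hx : 0 ≤ x) : poissonWeight n x ≤ 1 :=
  le_hasSum (hasSum_poissonWeight x) n fun k _ => poissonWeight_nonneg k hx

/-- Two summable sequences with first moments are close in `ℓ¹` once they are close at small
indices. -/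
lemma tsum_abs_sub_le {a b : ℕ → ℝ} (ha : ∀ n, 0 ≤ a n) (hb : ∀ n, 0 ≤ b n) {A B : ℝ}
    (hA : HasSum (fun n : ℕ => (n : ℝ) * a n) A) (hB : HasSum (fun n : ℕ => (n : ℝ) * b n) B)
    {M : ℕ} (hM : 0 < M) {δ : ℝ} (hδ : ∀ n < M, |a n - b n| ≤ δ) :
    Summable (fun n => |a n - b n|) ∧ ∑' n, |a n - b n| ≤ M * δ + (A + B) / M := by
  have hM' : (0 : ℝ) < M := by exact_mod_cast hM
  have h1 : HasSum (fun n => if n < M then δ else 0) (M * δ) := by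
    have := hasSum_sum_of_ne_finset_zero (L := SummationFilter.unconditional ℕ)
      (f := fun n => if n < M then δ else 0)
      (s := Finset.range M) (fun n hn => by
        have : ¬ n < M := by simpa using hn
        simp [this])
    convert this using 1
    rw [Finset.sum_congr rfl (g := fun _ => δ) (fun n hn => by simp [Finset.mem_range.1 hn])]
    simp
  have h2 := h1.add ((hA.add hB).div_const (M : ℝ))
  -- Markov's inequality termwise: for `n ≥ M`, `|a n - b n| ≤ a n + b n ≤ n (a n + b n) / M`.
  have hle : ∀ n, |a n - b n| ≤
      (if n < M then δ else 0) + ((n : ℝ) * a n + (n : ℝ) * b n) / M := by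
    intro n
    have h0 : 0 ≤ (n : ℝ) * a n + (n : ℝ) * b n :=
      add_nonneg (mul_nonneg (Nat.cast_nonneg n) (ha n)) (mul_nonneg (Nat.cast_nonneg n) (hb n))
    by_cases hn : n < M
    · simp only [hn, if_true]
      have : 0 ≤ ((n : ℝ) * a n + (n : ℝ) * b n) / M := by positivity
      linarith [hδ n hn]
    · simp only [hn, if_false, zero_add]
      have hn' : (M : ℝ) ≤ n := by exact_mod_cast not_lt.1 hn
      rw [le_div_iff₀ hM']
      have hab : |a n - b n| ≤ a n + b n := by
        rw [abs_le]
        constructor <;> linarith [ha n, hb n]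
      nlinarith [ha n, hb n, abs_nonneg (a n - b n)]
  have hs : Summable (fun n => |a n - b n|) :=
    Summable.of_nonneg_of_le (fun n => abs_nonneg _) hle h2.summable
  exact ⟨hs, hasSum_le hle hs.hasSum h2⟩

/-- Stability in `ℓ¹` of the normalisation `a ↦ a / ∑ a`. -/
lemma tsum_abs_div_sub_div_le {a b : ℕ → ℝ} (ha : ∀ n, 0 ≤ a n) {A B : ℝ} (hA0 : 0 < A)
    (hB0 : 0 < B) (hA : HasSum a A) (hs : Summable (fun n => |a n - b n|)) :
    ∑' n, |a n / A - b n / B| ≤ (∑' n, |a n - b n| + |A - B|) / B := by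
  have h2 := (hs.hasSum.add (hA.mul_right (|A - B| / A))).div_const B
  have hle : ∀ n, |a n / A - b n / B| ≤ (|a n - b n| + a n * (|A - B| / A)) / B := by
    intro n
    -- With this splitting the second term sums exactly to `|A - B| / B`, because `∑ a n = A`.
    have e : a n / A - b n / B = ((a n - b n) + a n * ((B - A) / A)) / B := by
      field_simp
      ring
    rw [e, abs_div, abs_of_pos hB0]
    gcongr
    refine (abs_add_le _ _).trans ?_
    rw [abs_mul, abs_of_nonneg (ha n), abs_div, abs_of_pos hA0, abs_sub_comm B A]
  have hs' := Summable.of_nonneg_of_le (fun n => abs_nonneg _) hle h2.summable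
  refine (hasSum_le hle hs'.hasSum h2).trans_eq ?_
  field_simp

lemma HasSum.avg {F : ℕ → ℝ → ℝ} {S : ℝ → ℝ} (h : ∀ x, HasSum (fun n => F n x) (S x)) {N : ℕ}
    (x : Fin N → ℝ) : HasSum (fun n => avg (F n) x) (avg S x) :=
  (hasSum_sum fun i _ => h (x i)).mul_left _

lemma avg_const_mul (c : ℝ) (h : ℝ → ℝ) {N : ℕ} (x : Fin N → ℝ) :
    avg (fun y => c * h y) x = c * avg h x := by
  unfold avg
  rw [← Finset.mul_sum]
  ring

lemma avg_nonneg {h : ℝ → ℝ} {N : ℕ} {x : Fin N → ℝ} (hx : ∀ i, 0 ≤ h (x i)) : 0 ≤ avg h x :=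
  mul_nonneg (by positivity) (Finset.sum_nonneg fun i _ => hx i)

lemma avg_mono {h h' : ℝ → ℝ} {N : ℕ} {x : Fin N → ℝ} (hx : ∀ i, h (x i) ≤ h' (x i)) :
    avg h x ≤ avg h' x :=
  mul_le_mul_of_nonneg_left (Finset.sum_le_sum fun i _ => hx i) (by positivity)

/-! ### Empirical quantities as averages. -/

section Empirical

variable {N : ℕ} (x : Fin N → ℝ)

lemma meanN_eq_avg : meanN x = avg (fun y => y) x := rfl

lemma nuN_eq_avg (hN : 0 < N) : nuN x = avg (fun y => y ^ 2) x / avg (fun y => y) x := by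
  have : (1 / (N : ℝ)) ≠ 0 := by positivity
  unfold nuN avg
  rw [mul_div_mul_left _ _ this]

lemma gN_eq_avg (n : ℕ) :
    gN x n = avg (fun y => y * poissonWeight n y) x / avg (fun y => y) x := by
  unfold gN avg meanN poissonWeight
  have : ∀ i, Real.exp (-x i) * x i ^ (n + 1) / (n.factorial : ℝ) =
      x i * (Real.exp (-x i) * x i ^ n / (n.factorial : ℝ)) := fun i => by ring
  simp only [this]
  rw [one_div, mul_inv, one_div, div_eq_mul_inv]
  ring

end Empirical

/-! ### Limit laws and moments of the capacity distribution. -/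

section Limit

variable {Ω : Type*} [MeasurableSpace Ω] {P : Measure Ω} {X : Ω → ℝ}

lemma gLim_eq (n : ℕ) :
    gLim P X n = (∫ ω, X ω * poissonWeight n (X ω) ∂P) / mu P X := by
  unfold gLim poissonWeight
  rw [one_div, div_eq_inv_mul]
  congr 2
  funext ω
  ring

/-- By nonnegativity the integrable sum `S` is itself the dominating function. This gives the total
mass and first moment of the limit sequences. -/
lemma hasSum_integral_of_nonneg {F : ℕ → ℝ → ℝ} {S : ℝ → ℝ} (hX : Measurable X)
    (hF : ∀ n, Measurable (F n)) (hpos : ∀ᵐ ω ∂P, 0 < X ω)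
    (hF0 : ∀ n x, 0 < x → 0 ≤ F n x) (hS : ∀ x, HasSum (fun n => F n x) (S x))
    (hint : Integrable (fun ω => S (X ω)) P) :
    HasSum (fun n => ∫ ω, F n (X ω) ∂P) (∫ ω, S (X ω) ∂P) := by
  refine hasSum_integral_of_dominated_convergence (fun n ω => F n (X ω))
    (fun n => ((hF n).comp hX).aestronglyMeasurable) (fun n => ?_)
    (Eventually.of_forall fun ω => (hS _).summable) ?_ (Eventually.of_forall fun ω => hS _)
  · filter_upwards [hpos] with ω hω
    rw [Real.norm_of_nonneg (hF0 n _ hω)]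
  · simpa only [(hS _).tsum_eq] using hint

/-- Moments from a polynomial tail bound. -/
lemma integrable_rpow_of_tail [IsProbabilityMeasure P] (hX : Measurable X)
    (hpos : ∀ᵐ ω ∂P, 0 < X ω) {c τ : ℝ}
    (htail : ∀ x : ℝ, 0 < x → 1 - P.real {ω | X ω ≤ x} ≤ c * x ^ (1 - τ)) {p : ℝ} (hp : 0 < p)
    (hpτ : p < τ - 1) : Integrable (fun ω => X ω ^ p) P := by
  have hnn : 0 ≤ᵐ[P] fun ω => X ω ^ p := by
    filter_upwards [hpos] with ω hω using Real.rpow_nonneg hω.le _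
  refine ⟨(by fun_prop : Measurable fun ω => X ω ^ p).aestronglyMeasurable, ?_⟩
  rw [hasFiniteIntegral_iff_ofReal hnn, lintegral_rpow_eq_lintegral_meas_lt_mul P
    (by filter_upwards [hpos] with ω hω using hω.le) hX.aemeasurable hp]
  refine ENNReal.mul_lt_top ENNReal.ofReal_lt_top ?_
  -- In the layer-cake integral of `P(X > t) t^(p-1)`, the range up to `1` needs only `p > 0`;
  -- beyond `1` the tail bound leaves `t^(p-τ)`, integrable because `p < τ - 1`.
  rw [← Set.Ioc_union_Ioi_eq_Ioi zero_le_one]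
  refine (lintegral_union_le _ _ _).trans_lt (ENNReal.add_lt_top.2 ⟨?_, ?_⟩)
  · have hi : IntegrableOn (fun t : ℝ => t ^ (p - 1)) (Set.Ioc 0 1) :=
      (intervalIntegrable_iff_integrableOn_Ioc_of_le zero_le_one).1
        (intervalIntegral.intervalIntegrable_rpow' (by linarith))
    refine lt_of_le_of_lt (lintegral_mono fun t => ?_) hi.lintegral_lt_top
    exact mul_le_of_le_one_left zero_le prob_le_one
  · have hi : IntegrableOn (fun t : ℝ => c * t ^ (p - τ)) (Set.Ioi 1) :=
      (integrableOn_Ioi_rpow_of_lt (by linarith) one_pos).const_mul c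
    refine lt_of_le_of_lt (setLIntegral_mono' measurableSet_Ioi fun t ht => ?_)
      hi.lintegral_lt_top
    have ht0 : (0 : ℝ) < t := one_pos.trans ht
    have hreal : P.real {ω | t < X ω} ≤ c * t ^ (1 - τ) := by
      refine le_trans (le_of_eq ?_) (htail t ht0)
      rw [← probReal_compl_eq_one_sub (measurableSet_le hX measurable_const)]
      congr 1
      ext ω
      simp
    rw [← ofReal_measureReal, ← ENNReal.ofReal_mul measureReal_nonneg]
    refine ENNReal.ofReal_le_ofReal ?_
    calc _ ≤ c * t ^ (1 - τ) * t ^ (p - 1) :=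
          mul_le_mul_of_nonneg_right hreal (by positivity)
      _ = c * t ^ (p - τ) := by
        rw [mul_assoc, ← Real.rpow_add ht0]
        congr 2
        ring

end Limit

/-! ### From closeness of averages to the three conditions. -/

lemma isBigO_rpow_neg {u : ℕ → ℝ} {α : ℝ} (C : ℝ) (hu : ∀ N, 0 ≤ u N)
    (h : ∀ᶠ N : ℕ in atTop, u N ≤ C * (N : ℝ) ^ (-α)) :
    u =O[atTop] (fun N : ℕ => (N : ℝ) ^ (-α)) := by
  refine IsBigO.of_bound C ?_
  filter_upwards [h] with N hN
  rwa [Real.norm_of_nonneg (hu N), Real.norm_of_nonneg (Real.rpow_nonneg (Nat.cast_nonneg N) _)]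

/-- The case of `tsum_abs_sub_le` with polynomial rates. -/
lemma tsum_abs_sub_le_rpow {a b : ℕ → ℝ} (ha : ∀ n, 0 ≤ a n) (hb : ∀ n, 0 ≤ b n) {A B : ℝ}
    (hA : HasSum (fun n : ℕ => (n : ℝ) * a n) A) (hB : HasSum (fun n : ℕ => (n : ℝ) * b n) B)
    {N : ℕ} (hN : 1 ≤ N)
    (hδ : ∀ n < ⌈(N : ℝ) ^ (1 / 8 : ℝ)⌉₊, |a n - b n| < (N : ℝ) ^ (-(1 / 4) : ℝ)) :
    Summable (fun n => |a n - b n|) ∧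
      ∑' n, |a n - b n| ≤ (2 + A + B) * (N : ℝ) ^ (-(1 / 8) : ℝ) := by
  have hN1 : (1 : ℝ) ≤ N := by exact_mod_cast hN
  have hN0 : (0 : ℝ) < N := by linarith
  have h1 : (1 : ℝ) ≤ (N : ℝ) ^ (1 / 8 : ℝ) := Real.one_le_rpow hN1 (by norm_num)
  set M := ⌈(N : ℝ) ^ (1 / 8 : ℝ)⌉₊
  have hMlo : (N : ℝ) ^ (1 / 8 : ℝ) ≤ M := Nat.le_ceil _
  have hMhi : (M : ℝ) ≤ 2 * (N : ℝ) ^ (1 / 8 : ℝ) := by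
    have := (Nat.ceil_lt_add_one (Real.rpow_nonneg hN0.le (1 / 8 : ℝ))).le
    linarith
  have hM0 : 0 < M := by
    have : (0 : ℝ) < M := by linarith
    exact_mod_cast this
  obtain ⟨hs, hle⟩ := tsum_abs_sub_le ha hb hA hB hM0 fun n hn => (hδ n hn).le
  refine ⟨hs, hle.trans ?_⟩
  have hA0 : 0 ≤ A := hA.nonneg fun n => mul_nonneg (Nat.cast_nonneg n) (ha n)
  have hB0 : 0 ≤ B := hB.nonneg fun n => mul_nonneg (Nat.cast_nonneg n) (hb n)
  have e1 : (M : ℝ) * (N : ℝ) ^ (-(1 / 4) : ℝ) ≤ 2 * (N : ℝ) ^ (-(1 / 8) : ℝ) := by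
    refine (mul_le_mul_of_nonneg_right hMhi (by positivity)).trans_eq ?_
    rw [mul_assoc, ← Real.rpow_add hN0]
    norm_num
  have e2 : (A + B) / M ≤ (A + B) * (N : ℝ) ^ (-(1 / 8) : ℝ) := by
    rw [Real.rpow_neg hN0.le, ← div_eq_mul_inv]
    gcongr
  linarith

lemma condC1_of_avg {lam : Capacities} {m₁ m₂ α : ℝ} (hm₁ : 0 < m₁) (hν : 1 < m₂ / m₁)
    (hα : 0 < α)
    (h1 : ∀ᶠ N : ℕ in atTop, |avg (fun y => y) (lam N) - m₁| ≤ (N : ℝ) ^ (-α))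
    (h2 : ∀ᶠ N : ℕ in atTop, |avg (fun y => y ^ 2) (lam N) - m₂| ≤ (N : ℝ) ^ (-α)) :
    CondC1 lam m₁ (m₂ / m₁) α := by
  have hm₂ : 0 < m₂ := by
    rw [lt_div_iff₀ hm₁] at hν
    linarith
  refine ⟨hm₁, hν, hα, isBigO_rpow_neg 1 (fun _ => abs_nonneg _) ?_,
    isBigO_rpow_neg ((m₁ + m₂) * (2 / m₁ ^ 2)) (fun _ => abs_nonneg _) ?_⟩
  · filter_upwards [h1] with N hN
    rwa [one_mul, meanN_eq_avg]
  have hsmall : ∀ᶠ N : ℕ in atTop, (N : ℝ) ^ (-α) < m₁ / 2 :=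
    ((tendsto_rpow_neg_atTop hα).comp tendsto_natCast_atTop_atTop).eventually
      (gt_mem_nhds (by positivity : (0 : ℝ) < m₁ / 2))
  filter_upwards [h1, h2, hsmall, eventually_gt_atTop 0] with N hN1 hN2 hN3 hN0
  rw [nuN_eq_avg _ hN0]
  set A := avg (fun y => y) (lam N)
  set B := avg (fun y => y ^ 2) (lam N)
  set δ := (N : ℝ) ^ (-α)
  have hA : m₁ / 2 ≤ A := by
    have := (abs_le.1 hN1).1
    linarith
  have hA0 : 0 < A := by linarith
  -- The numerator is at most `(m₁ + m₂) δ` and the denominator at least `m₁ ^ 2 / 2`, since `A ≥ m₁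
  -- / 2`; hence the constant announced above.
  have e : B / A - m₂ / m₁ = ((B - m₂) * m₁ - m₂ * (A - m₁)) / (A * m₁) := by
    field_simp
    ring
  rw [e, abs_div, abs_of_pos (mul_pos hA0 hm₁), div_le_iff₀ (by positivity)]
  have hnum : |(B - m₂) * m₁ - m₂ * (A - m₁)| ≤ (m₁ + m₂) * δ := by
    refine (abs_sub _ _).trans ?_
    rw [abs_mul, abs_mul, abs_of_pos hm₁, abs_of_pos hm₂]
    nlinarith
  refine hnum.trans ?_
  have hδ : 0 ≤ δ := Real.rpow_nonneg (Nat.cast_nonneg N) _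
  have hden : 1 ≤ 2 / m₁ ^ 2 * (A * m₁) := by
    rw [div_mul_eq_mul_div, le_div_iff₀ (by positivity)]
    nlinarith
  calc (m₁ + m₂) * δ = (m₁ + m₂) * δ * 1 := (mul_one _).symm
    _ ≤ (m₁ + m₂) * δ * (2 / m₁ ^ 2 * (A * m₁)) := by gcongr
    _ = _ := by ring

lemma hasSum_mul_avg_poissonWeight {N : ℕ} (x : Fin N → ℝ) :
    HasSum (fun n : ℕ => (n : ℝ) * avg (poissonWeight n) x) (avg (fun y => y) x) := by
  simpa only [avg_const_mul] using
    HasSum.avg (F := fun n y => (n : ℝ) * poissonWeight n y) hasSum_mul_poissonWeight x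

lemma hasSum_avg_mul_poissonWeight {N : ℕ} (x : Fin N → ℝ) :
    HasSum (fun n : ℕ => avg (fun y => y * poissonWeight n y) x) (avg (fun y => y) x) :=
  HasSum.avg (F := fun n y => y * poissonWeight n y)
    (fun y => by simpa using (hasSum_poissonWeight y).mul_left y) x

lemma hasSum_mul_mul_poissonWeight (y : ℝ) :
    HasSum (fun n : ℕ => (n : ℝ) * (y * poissonWeight n y)) (y ^ 2) := by
  have h := (hasSum_mul_poissonWeight y).mul_left y
  rw [← sq] at h
  exact h.congr_fun fun n => by ring

lemma hasSum_mul_avg_mul_poissonWeight {N : ℕ} (x : Fin N → ℝ) :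
    HasSum (fun n : ℕ => (n : ℝ) * avg (fun y => y * poissonWeight n y) x)
      (avg (fun y => y ^ 2) x) := by
  simpa only [avg_const_mul] using
    HasSum.avg (F := fun n y => (n : ℝ) * (y * poissonWeight n y)) hasSum_mul_mul_poissonWeight x

section Limit

variable {Ω : Type*} [MeasurableSpace Ω] {P : Measure Ω} {X : Ω → ℝ}

/-- The first moments that control large indices are the mean (for `f`) and the second moment (for
unnormalised `g`); `h1` and `h2` bound their empirical versions. The rate is the worse of `1/8` and
the rate `α` of the mean, which enters through normalisation. -/
lemma condC2_of_avg [IsProbabilityMeasure P] (hX : Measurable X) (hpos : ∀ᵐ ω ∂P, 0 < X ω)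
    (hi1 : Integrable X P) (hi2 : Integrable (fun ω => X ω ^ 2) P) (hmu : 0 < mu P X)
    {lam : Capacities} (hlam : ∀ N i, 0 < lam N i) {α : ℝ} (hα : 0 < α)
    (h1 : ∀ᶠ N : ℕ in atTop, |avg (fun y => y) (lam N) - mu P X| ≤ (N : ℝ) ^ (-α))
    (h2 : ∀ᶠ N : ℕ in atTop,
      |avg (fun y => y ^ 2) (lam N) - ∫ ω, X ω ^ 2 ∂P| ≤ (N : ℝ) ^ (-α))
    (hf : ∀ᶠ N : ℕ in atTop, ∀ n < ⌈(N : ℝ) ^ (1 / 8 : ℝ)⌉₊,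
      |avg (poissonWeight n) (lam N) - ∫ ω, poissonWeight n (X ω) ∂P| <
        (N : ℝ) ^ (-(1 / 4) : ℝ))
    (hg : ∀ᶠ N : ℕ in atTop, ∀ n < ⌈(N : ℝ) ^ (1 / 8 : ℝ)⌉₊,
      |avg (fun y => y * poissonWeight n y) (lam N) - ∫ ω, X ω * poissonWeight n (X ω) ∂P| <
        (N : ℝ) ^ (-(1 / 4) : ℝ)) :
    CondC2 lam (fLim P X) (gLim P X) (min (1 / 8) α) := by
  set m₂ := ∫ ω, X ω ^ 2 ∂P with hm₂
  have hm₂0 : 0 ≤ m₂ := integral_nonneg fun ω => sq_nonneg _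
  have hpw := measurable_poissonWeight
  have hb0 : ∀ n, 0 ≤ ∫ ω, poissonWeight n (X ω) ∂P := fun n => integral_nonneg_of_ae <| by
    filter_upwards [hpos] with ω hω using poissonWeight_nonneg n hω.le
  have hc0 : ∀ n, 0 ≤ ∫ ω, X ω * poissonWeight n (X ω) ∂P := fun n =>
    integral_nonneg_of_ae <| by
      filter_upwards [hpos] with ω hω using mul_nonneg hω.le (poissonWeight_nonneg n hω.le)
  have hbsum : HasSum (fun n => ∫ ω, poissonWeight n (X ω) ∂P) 1 := by
    simpa using hasSum_integral_of_nonneg (S := fun _ => 1) hX hpw hpos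
      (fun n x hx => poissonWeight_nonneg n hx.le) hasSum_poissonWeight (integrable_const _)
  have hbsum1 : HasSum (fun n : ℕ => (n : ℝ) * ∫ ω, poissonWeight n (X ω) ∂P) (mu P X) := by
    simpa only [integral_const_mul, mu] using
      hasSum_integral_of_nonneg (F := fun n y => (n : ℝ) * poissonWeight n y) (S := fun y => y)
        hX (fun n => (hpw n).const_mul _) hpos
        (fun n x hx => mul_nonneg (Nat.cast_nonneg n) (poissonWeight_nonneg n hx.le))
        hasSum_mul_poissonWeight hi1
  have hcsum : HasSum (fun n => ∫ ω, X ω * poissonWeight n (X ω) ∂P) (mu P X) :=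
    hasSum_integral_of_nonneg (F := fun n y => y * poissonWeight n y) (S := fun y => y)
      hX (fun n => measurable_id.mul (hpw n)) hpos
      (fun n x hx => mul_nonneg hx.le (poissonWeight_nonneg n hx.le))
      (fun y => by simpa using (hasSum_poissonWeight y).mul_left y) hi1
  have hcsum1 : HasSum (fun n : ℕ => (n : ℝ) * ∫ ω, X ω * poissonWeight n (X ω) ∂P) m₂ := by
    simpa only [integral_const_mul] using
      hasSum_integral_of_nonneg (F := fun n y => (n : ℝ) * (y * poissonWeight n y))
        (S := fun y => y ^ 2) hX (fun n => (measurable_id.mul (hpw n)).const_mul _) hpos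
        (fun n x hx => mul_nonneg (Nat.cast_nonneg n)
          (mul_nonneg hx.le (poissonWeight_nonneg n hx.le)))
        hasSum_mul_mul_poissonWeight hi2
  have ha0 : ∀ N n, 0 ≤ avg (poissonWeight n) (lam N) := fun N n =>
    avg_nonneg fun i => poissonWeight_nonneg n (hlam N i).le
  have hd0 : ∀ N n, 0 ≤ avg (fun y => y * poissonWeight n y) (lam N) := fun N n =>
    avg_nonneg fun i => mul_nonneg (hlam N i).le (poissonWeight_nonneg n (hlam N i).le)
  have hrate : ∀ {b : ℝ} {N : ℕ}, 1 ≤ N → min (1 / 8) α ≤ b →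
      (N : ℝ) ^ (-b) ≤ (N : ℝ) ^ (-(min (1 / 8) α)) := fun hN hb =>
    Real.rpow_le_rpow_of_exponent_le (by exact_mod_cast hN) (neg_le_neg hb)
  have hle1 : ∀ {N : ℕ}, 1 ≤ N → (N : ℝ) ^ (-α) ≤ 1 := fun hN =>
    Real.rpow_le_one_of_one_le_of_nonpos (by exact_mod_cast hN) (by linarith)
  have hdTV0 : ∀ p q : ℕ → ℝ, 0 ≤ dTV p q := fun p q =>
    mul_nonneg (by norm_num) (tsum_nonneg fun n => abs_nonneg _)
  -- For large `N` an empirical moment exceeds its limit by at most `1`, turning `2 + A + B` into `3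
  -- + 2 * mu P X` or `3 + 2 * m₂`. The latter becomes `4 + 2 * m₂` after adding the error of the
  -- mean.
  refine ⟨⟨hb0, hbsum⟩, ⟨fun n => ?_, ?_⟩, lt_min (by norm_num) hα,
    isBigO_rpow_neg (3 + 2 * mu P X) (fun N => hdTV0 _ _) ?_,
    isBigO_rpow_neg ((4 + 2 * m₂) / mu P X) (fun N => hdTV0 _ _) ?_⟩
  · rw [gLim_eq]
    exact div_nonneg (hc0 n) hmu.le
  · have := hcsum.div_const (mu P X)
    rw [div_self hmu.ne'] at this
    exact this.congr_fun fun n => (gLim_eq n)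
  · filter_upwards [h1, hf, eventually_ge_atTop 1] with N hN1 hNf hN
    obtain ⟨hs, hle⟩ := tsum_abs_sub_le_rpow (ha0 N) hb0 (hasSum_mul_avg_poissonWeight (lam N))
      hbsum1 hN hNf
    have hS0 : 0 ≤ ∑' n, |fN (lam N) n - fLim P X n| := tsum_nonneg fun n => abs_nonneg _
    have hA : avg (fun y => y) (lam N) ≤ mu P X + 1 := by
      linarith [(abs_le.1 hN1).2, hle1 hN]
    have hstep : dTV (fN (lam N)) (fLim P X) ≤ ∑' n, |fN (lam N) n - fLim P X n| := by
      unfold dTV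
      linarith
    refine hstep.trans (hle.trans ?_)
    refine mul_le_mul (by linarith) (hrate hN (min_le_left _ _)) (by positivity) (by linarith)
  · have hsmall : ∀ᶠ N : ℕ in atTop, (N : ℝ) ^ (-α) < mu P X :=
      ((tendsto_rpow_neg_atTop hα).comp tendsto_natCast_atTop_atTop).eventually
        (gt_mem_nhds hmu)
    filter_upwards [h1, h2, hg, hsmall, eventually_ge_atTop 1] with N hN1 hN2 hNg hNs hN
    obtain ⟨hs, hle⟩ := tsum_abs_sub_le_rpow (hd0 N) hc0
      (hasSum_mul_avg_mul_poissonWeight (lam N)) hcsum1 hN hNg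
    have hA0 : 0 < avg (fun y => y) (lam N) := by linarith [(abs_le.1 hN1).1]
    have hA : avg (fun y => y ^ 2) (lam N) ≤ m₂ + 1 := by
      linarith [(abs_le.1 hN2).2, hle1 hN]
    have hdiv := tsum_abs_div_sub_div_le (hd0 N) hA0 hmu
      (hasSum_avg_mul_poissonWeight (lam N)) hs
    simp only [← gN_eq_avg, ← gLim_eq] at hdiv
    have hS0 : 0 ≤ ∑' n, |gN (lam N) n - gLim P X n| := tsum_nonneg fun n => abs_nonneg _
    have hstep : dTV (gN (lam N)) (gLim P X) ≤ ∑' n, |gN (lam N) n - gLim P X n| := by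
      unfold dTV
      linarith
    refine hstep.trans (hdiv.trans ?_)
    rw [div_mul_eq_mul_div]
    refine div_le_div_of_nonneg_right ?_ hmu.le
    have r1 := hrate hN (min_le_left (1 / 8) α)
    have r2 := hN1.trans (hrate hN (min_le_right (1 / 8) α))
    have r3 : (2 + avg (fun y => y ^ 2) (lam N) + m₂) * (N : ℝ) ^ (-(1 / 8) : ℝ) ≤
        (3 + 2 * m₂) * (N : ℝ) ^ (-(min (1 / 8) α)) :=
      mul_le_mul (by linarith) r1 (by positivity) (by linarith)
    linarith

lemma condC3At_of_avg {lam : Capacities} {τ ε K : ℝ}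
    (hK : ∀ᶠ N : ℕ in atTop, avg (fun y => y ^ (τ - 1 - ε)) (lam N) ≤ K)
    (hmax : ∀ᶠ N : ℕ in atTop, ∀ i : Fin N, lam N i ≤ (N : ℝ) ^ (1 / (τ - 1) + ε)) :
    CondC3At lam τ ε := by
  refine ⟨lt_of_le_of_lt (limsup_le_of_le (a := (K : EReal)) ?_ ?_) (EReal.coe_lt_top K), hmax⟩
  · isBoundedDefault
  · filter_upwards [hK] with N hN
    exact EReal.coe_le_coe_iff.2 hN

/-- One moment bound and one bound on the maximum give `CondC3` for every `ε` at once. -/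
lemma condC3_of_avg {lam : Capacities} (hlam : ∀ N i, 0 < lam N i) {τ K : ℝ} (hτ : 3 < τ)
    (hK : ∀ᶠ N : ℕ in atTop, avg (fun y => y ^ (τ - 1)) (lam N) ≤ K)
    (hmax : ∀ᶠ N : ℕ in atTop, ∀ i : Fin N, lam N i ≤ (N : ℝ) ^ (1 / (τ - 1))) :
    CondC3 lam τ := by
  refine ⟨hτ, fun ε hε hε2 => condC3At_of_avg (K := 1 + K) ?_ ?_⟩
  -- Positivity of `1 / (τ - 1)` forces `ε < 1/2`, so `τ - 1 - ε` is nonnegative and `y ^ (τ - 1 -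
  -- ε) ≤ 1 + y ^ (τ - 1)`.
  · have hinv : 0 < 1 / (τ - 1) := by
      have : 0 < τ - 1 := by linarith
      positivity
    filter_upwards [hK, eventually_ge_atTop 1] with N hN hN1
    have hle : avg (fun y => y ^ (τ - 1 - ε)) (lam N) ≤
        avg (fun y => 1 + y ^ (τ - 1)) (lam N) := avg_mono fun i => by
      rcases le_total (lam N i) 1 with h | h
      · have h1 := Real.rpow_le_one (hlam N i).le h (by linarith : 0 ≤ τ - 1 - ε)
        have h2 := Real.rpow_nonneg (hlam N i).le (τ - 1)
        linarith
      · have := Real.rpow_le_rpow_of_exponent_le h (by linarith : τ - 1 - ε ≤ τ - 1)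
        linarith
    have heq : avg (fun y => 1 + y ^ (τ - 1)) (lam N) =
        1 + avg (fun y => y ^ (τ - 1)) (lam N) := by
      have : (N : ℝ) ≠ 0 := by positivity
      unfold avg
      rw [Finset.sum_add_distrib]
      simp
      field_simp
    linarith
  · filter_upwards [hmax, eventually_ge_atTop 1] with N hN hN1 i
    exact (hN i).trans (Real.rpow_le_rpow_of_exponent_le (by exact_mod_cast hN1) (by linarith))

end Limit

/-! ### Probability of the good events. -/

section Probability

variable {Ω : Type*} [MeasurableSpace Ω] {P : Measure Ω} [IsProbabilityMeasure P] {L : ℕ → Ω → ℝ}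

/-- Polynomial concentration of empirical moments. -/
lemma exists_hasProbOneSubPoly_moment (hmeas : ∀ i, Measurable (L i)) (hindep : iIndepFun L P)
    (hident : ∀ i, IdentDistrib (L i) (L 0) P P) (hpos : ∀ᵐ ω ∂P, 0 < L 0 ω) {c τ : ℝ}
    (htail : ∀ x : ℝ, 0 < x → 1 - P.real {ω | L 0 ω ≤ x} ≤ c * x ^ (1 - τ)) {p : ℝ} (hp : 0 < p)
    (hpτ : p < τ - 1) :
    ∃ a β : ℝ, 0 < a ∧ 0 < β ∧ HasProbOneSubPoly P L
      (fun N => {x | |avg (fun y => y ^ p) x - ∫ ω, L 0 ω ^ p ∂P| ≤ (N : ℝ) ^ (-a)}) β := by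
  -- The second entry makes `p * s` at most the midpoint of `p` and `τ - 1`, so `|Λ ^ p| ^ s` is
  -- integrable; the cap `2` is what the truncation argument requires.
  set s : ℝ := min 2 ((1 + (τ - 1) / p) / 2) with hs
  have hq : 1 < (τ - 1) / p := by rwa [one_lt_div hp]
  have hs1 : 1 < s := lt_min (by norm_num) (by linarith)
  have hps : p * s < τ - 1 := by
    have h1 : p * s ≤ p * ((1 + (τ - 1) / p) / 2) :=
      mul_le_mul_of_nonneg_left (min_le_right _ _) hp.le
    have h2 : p * ((1 + (τ - 1) / p) / 2) = (p + (τ - 1)) / 2 := by field_simp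
    linarith
  have hint := integrable_rpow_of_tail (hmeas 0) hpos htail (mul_pos hp (by linarith : 0 < s)) hps
  refine ⟨(s - 1) / 4, s - 1 - 2 * ((s - 1) / 4), by linarith, by linarith,
    hasProbOneSubPoly_avg (h := fun y => y ^ p) hmeas hindep hident (by fun_prop) (min_le_left _ _)
      (by linarith) (by linarith) (hint.congr ?_)
      (integrable_rpow_of_tail (hmeas 0) hpos htail hp hpτ)⟩
  filter_upwards [hpos] with ω hω
  rw [abs_of_nonneg (Real.rpow_nonneg hω.le _), ← Real.rpow_mul hω.le]

lemma exists_hasProbOneSubPoly_moment_le (hmeas : ∀ i, Measurable (L i)) (hindep : iIndepFun L P)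
    (hident : ∀ i, IdentDistrib (L i) (L 0) P P) (hpos : ∀ᵐ ω ∂P, 0 < L 0 ω) {c τ : ℝ}
    (htail : ∀ x : ℝ, 0 < x → 1 - P.real {ω | L 0 ω ≤ x} ≤ c * x ^ (1 - τ)) {p : ℝ} (hp : 0 < p)
    (hpτ : p < τ - 1) :
    ∃ K β : ℝ, 0 < β ∧ HasProbOneSubPoly P L
      (fun N => {x | avg (fun y => y ^ p) x ≤ K}) β := by
  obtain ⟨a, β, ha, hβ, h⟩ :=
    exists_hasProbOneSubPoly_moment hmeas hindep hident hpos htail hp hpτ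
  refine ⟨∫ ω, L 0 ω ^ p ∂P + 1, β, hβ, h.mono (fun N => ?_) ?_⟩
  · exact measurableSet_le (measurable_avg (by fun_prop) N) measurable_const
  · filter_upwards [eventually_ge_atTop 1] with N hN x hx
    have h1 : (N : ℝ) ^ (-a) ≤ 1 :=
      Real.rpow_le_one_of_one_le_of_nonpos (by exact_mod_cast hN) (by linarith)
    rw [Set.mem_ofPred_eq, abs_le] at hx
    rw [Set.mem_ofPred_eq]
    linarith [hx.2]

/-- Union bound over `N` tails, each at most `c N^(γ(1-τ))`. The resulting exponent is positive
exactly when `γ > 1 / (τ - 1)`, given `τ > 1`. -/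
lemma hasProbOneSubPoly_max_le (hmeas : ∀ i, Measurable (L i))
    (hident : ∀ i, IdentDistrib (L i) (L 0) P P) {c τ : ℝ}
    (htail : ∀ x : ℝ, 0 < x → 1 - P.real {ω | L 0 ω ≤ x} ≤ c * x ^ (1 - τ)) (γ : ℝ) :
    HasProbOneSubPoly P L (fun N => {x | ∀ i, x i ≤ (N : ℝ) ^ γ}) (γ * (τ - 1) - 1) := by
  refine HasProbOneSubPoly.of_compl_le hmeas (fun N => ?_) c ?_
  · simp only [Set.ofPred_forall]
    exact MeasurableSet.iInter fun i => measurableSet_le (measurable_pi_apply i) measurable_const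
  filter_upwards [eventually_ge_atTop 1] with N hN
  have hN0 : (0 : ℝ) < N := by exact_mod_cast hN
  have hsub : {ω | (fun i : Fin N => L i ω) ∉ {x : Fin N → ℝ | ∀ i, x i ≤ (N : ℝ) ^ γ}} ⊆
      ⋃ i ∈ (Finset.univ : Finset (Fin N)), {ω | L i ω ≤ (N : ℝ) ^ γ}ᶜ := by
    intro ω hω
    simpa using hω
  have hone : ∀ i : ℕ, P.real {ω | L i ω ≤ (N : ℝ) ^ γ}ᶜ ≤ c * ((N : ℝ) ^ γ) ^ (1 - τ) := by
    intro i
    rw [probReal_compl_eq_one_sub (measurableSet_le (hmeas i) measurable_const)]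
    refine le_trans (le_of_eq ?_) (htail _ (Real.rpow_pos_of_pos hN0 γ))
    have := (hident i).measure_mem_eq (measurableSet_Iic (a := (N : ℝ) ^ γ))
    exact congrArg (fun z : ENNReal => 1 - z.toReal) this
  refine (measureReal_mono hsub (measure_ne_top _ _)).trans
    ((measureReal_biUnion_finset_le _ _).trans
      ((Finset.sum_le_sum fun (i : Fin N) _ => hone i).trans_eq ?_))
  simp only [Finset.sum_const, Finset.card_univ, Fintype.card_fin, nsmul_eq_mul]
  rw [← Real.rpow_mul hN0.le, show -(γ * (τ - 1) - 1) = 1 + γ * (1 - τ) by ring,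
    Real.rpow_add hN0, Real.rpow_one]
  ring

/-- With probability `1 - O(N^{-β})` the conditions on means and offspring laws hold. -/
lemma exists_hasProbOneSubPoly_condC1_condC2 (hmeas : ∀ i, Measurable (L i))
    (hindep : iIndepFun L P) (hident : ∀ i, IdentDistrib (L i) (L 0) P P)
    (hpos : ∀ᵐ ω ∂P, 0 < L 0 ω) {c τ : ℝ} (hτ : 3 < τ)
    (htail : ∀ x : ℝ, 0 < x → 1 - P.real {ω | L 0 ω ≤ x} ≤ c * x ^ (1 - τ))
    (hν : 1 < nu P (L 0)) :
    ∃ α₁ α₂ : ℝ, 0 < α₁ ∧ 0 < α₂ ∧ ∃ (J : (N : ℕ) → Set (Fin N → ℝ)) (β : ℝ), 0 < β ∧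
      HasProbOneSubPoly P L J β ∧ HoldsOn J (fun lam =>
        CondC1 lam (mu P (L 0)) (nu P (L 0)) α₁ ∧
        CondC2 lam (fLim P (L 0)) (gLim P (L 0)) α₂) := by
  have hi1 : Integrable (L 0) P := by
    simpa using integrable_rpow_of_tail (hmeas 0) hpos htail one_pos (by linarith)
  have hi2 : Integrable (fun ω => L 0 ω ^ 2) P := by
    simpa using integrable_rpow_of_tail (hmeas 0) hpos htail two_pos (by linarith)
  have hmu : 0 < mu P (L 0) := by
    refine (integral_pos_iff_support_of_nonneg_ae
      (by filter_upwards [hpos] with ω hω using hω.le) hi1).2 ?_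
    have hsupp : Function.support (L 0) =ᵐ[P] Set.univ := by
      rw [ae_eq_univ]
      refine measure_mono_null ?_ (ae_iff.1 hpos)
      intro ω hω
      have : L 0 ω = 0 := by simpa using hω
      simp [this]
    rw [measure_congr hsupp, measure_univ]
    exact one_pos
  obtain ⟨a, β₁, ha, hβ₁, H1⟩ :=
    exists_hasProbOneSubPoly_moment hmeas hindep hident hpos htail one_pos (by linarith)
  obtain ⟨b, β₂, hb, hβ₂, H2⟩ :=
    exists_hasProbOneSubPoly_moment hmeas hindep hident hpos htail two_pos (by linarith)
  simp only [Real.rpow_one, Real.rpow_two] at H1 H2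
  have hp1 : ∀ n, ∀ᵐ ω ∂P, |poissonWeight n (L 0 ω)| ≤ 1 := fun n => by
    filter_upwards [hpos] with ω hω
    rw [abs_of_nonneg (poissonWeight_nonneg n hω.le)]
    exact poissonWeight_le_one n hω.le
  have hm1 : ∀ n, Measurable fun y => y * poissonWeight n y := fun n =>
    measurable_id.mul (measurable_poissonWeight n)
  have hp2 : ∀ n, ∀ᵐ ω ∂P, |L 0 ω * poissonWeight n (L 0 ω)| ≤ |L 0 ω| := fun n => by
    filter_upwards [hp1 n] with ω hω
    rw [abs_mul]
    exact mul_le_of_le_one_right (abs_nonneg _) hω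
  have hL2 : MemLp (L 0) 2 P :=
    (memLp_two_iff_integrable_sq (hmeas 0).aestronglyMeasurable).2 hi2
  have hF2 : ∀ n, MemLp (fun ω => poissonWeight n (L 0 ω)) 2 P := fun n =>
    MemLp.of_bound ((measurable_poissonWeight n).comp (hmeas 0)).aestronglyMeasurable 1
      (hp1 n)
  have hG2 : ∀ n, MemLp (fun ω => L 0 ω * poissonWeight n (L 0 ω)) 2 P := fun n =>
    hL2.mono ((hm1 n).comp (hmeas 0)).aestronglyMeasurable (hp2 n)
  -- The union bound needs second moments bounded uniformly in `n`. Poisson weights are at most `1`,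
  -- so `1` serves here and `E[Λ ^ 2]` serves for the size-biased statistics.
  have H3 := hasProbOneSubPoly_avg_family (h := poissonWeight) (m := 1) hmeas hindep hident
    measurable_poissonWeight hF2 (fun n => by
      have := integral_mono_ae (hF2 n).integrable_sq (integrable_const (1 : ℝ)) (by
        filter_upwards [hp1 n] with ω hω
        exact (sq_le_one_iff_abs_le_one _).2 hω)
      simpa using this)
  have H4 := hasProbOneSubPoly_avg_family (h := fun n y => y * poissonWeight n y)
    (m := ∫ ω, L 0 ω ^ 2 ∂P) hmeas hindep hident hm1 hG2 (fun n =>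
      integral_mono_ae (hG2 n).integrable_sq hi2 (by
        filter_upwards [hp2 n] with ω hω
        exact sq_le_sq.2 hω))
  have hα : 0 < min a b := lt_min ha hb
  refine ⟨min a b, min (1 / 8) (min a b), hα, lt_min (by norm_num) hα, _, _, ?_,
    (H1.inter hmeas H2).inter hmeas (H3.inter hmeas H4), ?_⟩
  · exact lt_min (lt_min hβ₁ hβ₂) (by norm_num)
  intro lam hlam hJ
  have h1 : ∀ᶠ N : ℕ in atTop,
      |avg (fun y => y) (lam N) - mu P (L 0)| ≤ (N : ℝ) ^ (-(min a b)) := by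
    filter_upwards [hJ, eventually_ge_atTop 1] with N hN hN1
    exact hN.1.1.trans (Real.rpow_le_rpow_of_exponent_le (by exact_mod_cast hN1)
      (neg_le_neg (min_le_left _ _)))
  have h2 : ∀ᶠ N : ℕ in atTop,
      |avg (fun y => y ^ 2) (lam N) - ∫ ω, L 0 ω ^ 2 ∂P| ≤ (N : ℝ) ^ (-(min a b)) := by
    filter_upwards [hJ, eventually_ge_atTop 1] with N hN hN1
    exact hN.1.2.trans (Real.rpow_le_rpow_of_exponent_le (by exact_mod_cast hN1)
      (neg_le_neg (min_le_right _ _)))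
  exact ⟨condC1_of_avg hmu hν hα h1 h2, condC2_of_avg (hmeas 0) hpos hi1 hi2 hmu hlam hα h1 h2
    (hJ.mono fun N hN => hN.2.1) (hJ.mono fun N hN => hN.2.2)⟩

end Probability
end CapacityGraph
end

/-! ### The theorem. -/

open CapacityGraph in
theorem theorem1p4 {Ω : Type*} [MeasurableSpace Ω] (P : Measure Ω) [IsProbabilityMeasure P]
    (L : ℕ → Ω → ℝ)
    (hmeas : ∀ i, Measurable (L i))
    (hindep : iIndepFun L P)
    (hident : ∀ i, IdentDistrib (L i) (L 0) P P)
    (hpos : ∀ i, ∀ᵐ ω ∂P, 0 < L i ω)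
    (c τ : ℝ) (hc : 0 < c) (hτ : 3 < τ)
    (htail : ∀ x : ℝ, 0 < x → 1 - P.real {ω | L 0 ω ≤ x} ≤ c * x ^ (1 - τ))
    (hν : 1 < nu P (L 0)) :
    ∃ α₁ α₂ : ℝ, 0 < α₁ ∧ 0 < α₂ ∧
      (∀ τ' : ℝ, 3 < τ' → τ' < τ →
        ∃ (J : (N : ℕ) → Set (Fin N → ℝ)) (β : ℝ), 0 < β ∧ HasProbOneSubPoly P L J β ∧
          HoldsOn J (fun lam =>
            CondC1 lam (mu P (L 0)) (nu P (L 0)) α₁ ∧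
            CondC2 lam (fLim P (L 0)) (gLim P (L 0)) α₂ ∧
            CondC3 lam τ')) ∧
      (∀ ε : ℝ, 0 < ε → 1 / (τ - 1) + ε < 1 / 2 →
        ∃ (J : (N : ℕ) → Set (Fin N → ℝ)) (β : ℝ), 0 < β ∧ HasProbOneSubPoly P L J β ∧
          HoldsOn J (fun lam =>
            CondC1 lam (mu P (L 0)) (nu P (L 0)) α₁ ∧
            CondC2 lam (fLim P (L 0)) (gLim P (L 0)) α₂ ∧
            CondC3At lam τ ε)) := by
  -- The rates are fixed before `τ'` and `ε`; only the extra events for the third condition depend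
  -- on those.
  obtain ⟨α₁, α₂, hα₁, hα₂, J, β, hβ, hJ, hQ⟩ := exists_hasProbOneSubPoly_condC1_condC2
    hmeas hindep hident (hpos 0) hτ htail hν
  refine ⟨α₁, α₂, hα₁, hα₂, fun τ' h3 hτ' => ?_, fun ε hε hε2 => ?_⟩
  -- The sets must serve all `ε` at once, so both bounds are taken at `ε = 0`. The gap `τ' < τ` pays
  -- for this: the moment of order `τ' - 1` is finite and the maximum has exponent `(τ - 1) / (τ' -
  -- 1) - 1 > 0`.
  · obtain ⟨K, β', hβ', hK⟩ := exists_hasProbOneSubPoly_moment_le hmeas hindep hident (hpos 0)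
      htail (p := τ' - 1) (by linarith) (by linarith)
    have hmax := hasProbOneSubPoly_max_le hmeas hident htail (1 / (τ' - 1))
    refine ⟨_, _, ?_, hJ.inter hmeas (hK.inter hmeas hmax), fun lam hlam hmem => ?_⟩
    · refine lt_min hβ (lt_min hβ' ?_)
      have : 1 < (τ - 1) / (τ' - 1) := by
        rw [one_lt_div (by linarith)]
        linarith
      rw [one_div_mul_eq_div]
      linarith
    · obtain ⟨h1, h2⟩ := hQ lam hlam (hmem.mono fun N hN => hN.1)
      exact ⟨h1, h2, condC3_of_avg hlam h3 (hmem.mono fun N hN => hN.2.1)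
        (hmem.mono fun N hN => hN.2.2)⟩
  -- At `τ` itself there is no such gap, and the fixed `ε` supplies the room in both bounds; the
  -- sets depend on it.
  · have hinv : 0 < 1 / (τ - 1) := one_div_pos.2 (by linarith)
    obtain ⟨K, β', hβ', hK⟩ := exists_hasProbOneSubPoly_moment_le hmeas hindep hident (hpos 0)
      htail (p := τ - 1 - ε) (by linarith) (by linarith)
    have hmax := hasProbOneSubPoly_max_le hmeas hident htail (1 / (τ - 1) + ε)
    refine ⟨_, _, ?_, hJ.inter hmeas (hK.inter hmeas hmax), fun lam hlam hmem => ?_⟩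
    · refine lt_min hβ (lt_min hβ' ?_)
      have hτ1 : 0 < τ - 1 := by linarith
      have : (1 / (τ - 1) + ε) * (τ - 1) - 1 = ε * (τ - 1) := by
        field_simp
        ring
      rw [this]
      positivity
    · obtain ⟨h1, h2⟩ := hQ lam hlam (hmem.mono fun N hN => hN.1)
      exact ⟨h1, h2, condC3At_of_avg (hmem.mono fun N hN => hN.2.1)
        (hmem.mono fun N hN => hN.2.2)⟩
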